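/- Let $\mathcal{H}$ and $\mathcal{G}$ be real Hilbert spaces. For a set-valued operator $A\colon\mathcal{H}\to 2^{\mathcal{H}}$, let $\operatorname{gra}A=\{(x,u)\in\mathcal{H}\times\mathcal{H} : u\in Ax\}$ be its graph, let $\operatorname{ran}A=\bigcup_{x}Ax$ be its range (and likewise for operators from $\mathcal{H}$ to $2^{\mathcal{G}}$), and let $A^{-1}$ be its inverse, i.e. $x\in A^{-1}u\Leftrightarrow u\in Ax$. The operator $A$ is monotone if $\langle x_1-x_2, u_1-u_2\rangle\ge 0$ for all $(x_1,u_1),(x_2,u_2)\in\operatorname{gra}A$, and maximally monotone if moreover no monotone operator has a graph that properly contains $\operatorname{gra}A$. For a bounded linear operator $L\colon\mathcal{H}\to\mathcal{G}$ with adjoint $L^*$, a set-valued operator $B\colon\mathcal{G}\to 2^{\mathcal{G}}$ and $\gamma>0$, let $$L^*\triangleright B=(L^*\circ B^{-1}\circ L)^{-1},\qquad L\diamond_\gamma B=L^*\triangleright(B+\gamma^{-1}\mathrm{Id}_{\mathcal{G}})-\gamma^{-1}\mathrm{Id}_{\mathcal{H}},\qquad L\blacklozenge_\gamma B=(L\diamond_{1/\gamma}B^{-1})^{-1};$$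 the operator $L\blacklozenge_\gamma B\colon\mathcal{H}\to2^{\mathcal{H}}$ is the resolvent cocomposition of $B$ and $L$ with parameter $\gamma$. A sequence $(A_n)_{n\in\mathbb{N}}$ of operators from $\mathcal{H}$ to $2^{\mathcal{H}}$ graph-converges to $A$ if $\operatorname{gra}A$ is both the lower limit of $(\operatorname{gra}A_n)$ (the set of limits of convergent sequences $(z_n)_{n\in\mathbb{N}}$ with $z_n\in\operatorname{gra}A_n$ for every $n$) and its upper limit (the set of limits of convergent sequences $(z_n)_{n\in\mathbb{N}}$ with $z_n\in\operatorname{gra}A_{k_n}$ for every $n$, for some strictly increasing sequence $(k_n)_{n\in\mathbb{N}}$ in $\mathbb{N}$). A family $(A_\gamma)_{\gamma>0}$ graph-converges to $A$ as $0<\gamma\to0$ if $(A_{\gamma_n})_{n\in\mathbb{N}}$ graph-converges to $A$ for every sequence $(\gamma_n)_{n\in\mathbb{N}}$ in $(0,+\infty)$ with $\gamma_n\to0$. Equip $\mathcal{H}\times\mathcal{H}$ with the norm $\max\{\|x\|,\|u\|\}$ (an equivalent norm yields the same notion of convergence below) and, for $\rho>0$, set $$\operatorname{haus}_\rho(A_1,A_2)=\max\Big\{\sup_{z\in\operatorname{gra}A_1,\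 \|z\|\le\rho}d(z,\operatorname{gra}A_2),\ \sup_{z\in\operatorname{gra}A_2,\ \|z\|\le\rho}d(z,\operatorname{gra}A_1)\Big\}\in[0,+\infty],$$ where suprema over the empty set are $0$. Suppose that $\|L\|\le1$, that $B$ is maximally monotone, and that $L^*\circ B\circ L$ is maximally monotone. Then the following hold: (i) $L\blacklozenge_\gamma B$ graph-converges to $L^*\circ B\circ L$ as $0<\gamma\to0$. (ii) Suppose that one of the following is satisfied: (a) $\operatorname{ran}(B\circ L)$ is bounded; (b) there exists a bounded linear operator $S\colon\mathcal{H}\to\mathcal{G}$ such that $S\circ L^*$ is invertible. Then, for every $\rho\in(0,+\infty)$, $\lim_{0<\gamma\to0}\operatorname{haus}_\rho(L\blacklozenge_\gamma B,\,L^*\circ B\circ L)=0$. -/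

import Mathlib

open Filter Topology
open scoped ENNReal

namespace ResolventComp

section Operators

variable {H G : Type*} [NormedAddCommGroup H] [InnerProductSpace ℝ H]
  [NormedAddCommGroup G] [InnerProductSpace ℝ G]

/-- The graph `{(x, u) | u ∈ A x}` of a set-valued operator. -/
def gra {X Y : Type*} (A : X → Set Y) : Set (X × Y) := {p | p.2 ∈ A p.1}

/-- The range of a set-valued operator. -/
def ran {X Y : Type*} (A : X → Set Y) : Set Y := {u | ∃ x, u ∈ A x}

/-- The inverse of a set-valued operator: `x ∈ A⁻¹ u` if and only if `u ∈ A x`. -/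
def inv {X Y : Type*} (A : X → Set Y) : Y → Set X := fun u => {x | u ∈ A x}

/-- The operator `A + c Id`. -/
def addId (A : H → Set H) (c : ℝ) : H → Set H := fun x => (fun u => u + c • x) '' A x

/-- The operator `A - c Id`. -/
def subId (A : H → Set H) (c : ℝ) : H → Set H := fun x => (fun u => u - c • x) '' A x

/-- Monotonicity of a set-valued operator on a real inner product space. -/
def IsMonotoneOp (A : H → Set H) : Prop :=
  ∀ x₁ u₁, (x₁, u₁) ∈ gra A → ∀ x₂ u₂, (x₂, u₂) ∈ gra A → 0 ≤ inner ℝ (x₁ - x₂) (u₁ - u₂)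

/-- Maximal monotonicity: `A` is monotone and no monotone operator has a graph that properly
contains the graph of `A`. -/
def IsMaximallyMonotone (A : H → Set H) : Prop :=
  IsMonotoneOp A ∧ ¬ ∃ A' : H → Set H, IsMonotoneOp A' ∧ gra A ⊂ gra A'

variable [CompleteSpace H] [CompleteSpace G]

/-- The parallel composition `M ▷ B = (M ∘ B⁻¹ ∘ M*)⁻¹` of `B : G → 2^G` by a bounded linear
operator `M : G → H`. -/
noncomputable def parallelComp (M : G →L[ℝ] H) (B : G → Set G) : H → Set H :=
  inv (fun u => M '' inv B (ContinuousLinearMap.adjoint M u))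

/-- The resolvent composition with parameter `γ`: `L* ▷ (B + γ⁻¹ Id) - γ⁻¹ Id`. -/
noncomputable def resolventComp (L : H →L[ℝ] G) (γ : ℝ) (B : G → Set G) : H → Set H :=
  subId (parallelComp (ContinuousLinearMap.adjoint L) (addId B γ⁻¹)) γ⁻¹

/-- The resolvent cocomposition of `B` and `L` with parameter `γ`: the inverse of the resolvent
composition of `B⁻¹` and `L` with parameter `1 / γ`. -/
noncomputable def resolventCocomp (L : H →L[ℝ] G) (γ : ℝ) (B : G → Set G) : H → Set H :=
  inv (resolventComp L (1 / γ) (inv B))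

/-- The standard composition `L* ∘ B ∘ L`. -/
noncomputable def compositeOp (L : H →L[ℝ] G) (B : G → Set G) : H → Set H :=
  fun x => ContinuousLinearMap.adjoint L '' B (L x)

end Operators

section SetConvergence

/-- The (Painlevé–Kuratowski) lower limit of a sequence of sets. -/
def lowerLimit {X : Type*} [TopologicalSpace X] (C : ℕ → Set X) : Set X :=
  {x | ∃ s : ℕ → X, (∀ n, s n ∈ C n) ∧ Tendsto s atTop (𝓝 x)}

/-- The (Painlevé–Kuratowski) upper limit of a sequence of sets: limits of sequences whose
terms are chosen in the sets of a subsequence. -/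
def upperLimit {X : Type*} [TopologicalSpace X] (C : ℕ → Set X) : Set X :=
  {x | ∃ (s : ℕ → X) (k : ℕ → ℕ), StrictMono k ∧ (∀ n, s n ∈ C (k n)) ∧ Tendsto s atTop (𝓝 x)}

/-- `C n → D` in the Painlevé–Kuratowski sense. -/
def PKConverges {X : Type*} [TopologicalSpace X] (C : ℕ → Set X) (D : Set X) : Prop :=
  lowerLimit C = D ∧ upperLimit C = D

/-- Graph-convergence of a sequence of set-valued operators. -/
def GraphConverges {X : Type*} [TopologicalSpace X] (A : ℕ → X → Set X) (A₀ : X → Set X) : Prop :=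
  PKConverges (fun n => gra (A n)) (gra A₀)

/-- The excess of `C` on `D`: the supremum of the distances to `D` of the points of `C`.
It is `0` if `C` is empty, and `∞` if only `D` is. -/
noncomputable def excess {X : Type*} [PseudoEMetricSpace X] (C D : Set X) : ℝ≥0∞ :=
  ⨆ x ∈ C, Metric.infEDist x D

/-- The `ρ`-Hausdorff distance between two subsets of a normed space. -/
noncomputable def hausSet {X : Type*} [NormedAddCommGroup X] (ρ : ℝ) (C D : Set X) : ℝ≥0∞ :=
  max (excess (C ∩ Metric.closedBall 0 ρ) D) (excess (D ∩ Metric.closedBall 0 ρ) C)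

/-- The `ρ`-Hausdorff distance between two set-valued operators, that is, between their graphs.
The product carries the norm `max ‖x‖ ‖u‖`. -/
noncomputable def hausOp {X : Type*} [NormedAddCommGroup X] (ρ : ℝ) (A B : X → Set X) : ℝ≥0∞ :=
  hausSet ρ (gra A) (gra B)

end SetConvergence

end ResolventComp

/-!
The graph of the resolvent cocomposition `A_γ` of `B` and `L` consists of the pairs `(x, L* y)` with
`y ∈ B (L x - γ (y - L L* y))`, whereas the graph of `A = L* ∘ B ∘ L` consists of the pairs
`(x, L* y)` with `y ∈ B (L x)`. Suppose that a point `(x', L* y')` of the first graph and a point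
`(x, L* y)` of the second one have the same sum `x' + L* y' = x + L* y`. Monotonicity of `B`,
together with the positivity of the self-adjoint operator `Id - L L*`, then yields
`‖x' - x‖² ≤ (γ / 4) ‖y‖²` (`norm_sub_sq_le`). In other words, the resolvents of `A_γ` converge
pointwise to that of `A` at the rate `√γ`.

Such pairs exist because `Id + A` and `Id + A_γ` are onto. For the maximally monotone operator `A`
this is Minty's theorem (`exists_mem_add_eq`), proved here by minimizing the Fitzpatrick function of
the operator plus half of the squared norm. For `A_γ` the equation becomes
`p + λ y - Q y = w` with `y ∈ B p` and `‖Q‖ < λ`, which is solved by Minty's theorem for `B`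
and the contraction principle (`exists_mem_add_smul_sub_eq`).

Pointwise convergence of the resolvents puts the graph of `A` in the lower limit, and maximality of
`A` puts the upper limit in its graph. For the `ρ`-Hausdorff distance the estimate has to be uniform
over bounded parts of the graphs, that is, `y` has to be bounded when `L* y` is. Each of the two
alternative assumptions gives this.
-/

namespace ResolventComp

open ContinuousLinearMap (adjoint)

/-! ### Minimizing a convex function plus half of the squared norm -/

section Minimization

variable {X : Type*} [NormedAddCommGroup X] [InnerProductSpace ℝ X]

/-- Almost minimizers of `t + ‖z‖² / 2` over a convex set of pairs `(z, t)` have first components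
that are close to each other, since the value at their midpoint is at least the infimum. -/
theorem norm_sub_sq_le_of_almost_min {E : Set (X × ℝ)} (hE : Convex ℝ E) {m : ℝ}
    (hm : ∀ q ∈ E, m ≤ q.2 + ‖q.1‖ ^ 2 / 2) {q r : X × ℝ} (hq : q ∈ E) (hr : r ∈ E) {ε δ : ℝ}
    (hqε : q.2 + ‖q.1‖ ^ 2 / 2 ≤ m + ε) (hrδ : r.2 + ‖r.1‖ ^ 2 / 2 ≤ m + δ) :
    ‖q.1 - r.1‖ ^ 2 ≤ 4 * (ε + δ) := by
  have h := hm _ (hE hq hr (by norm_num : (0 : ℝ) ≤ 1 / 2) (by norm_num : (0 : ℝ) ≤ 1 / 2)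
    (by norm_num))
  simp only [Prod.fst_add, Prod.smul_fst, Prod.snd_add, Prod.smul_snd, smul_eq_mul,
    ← smul_add, norm_smul, mul_pow] at h
  have hp := parallelogram_law_with_norm ℝ q.1 r.1
  norm_num at h
  nlinarith

/-- On a closed convex set of pairs `(z, t)`, such as the epigraph of a closed convex function, a
minimizer `(z₀, t₀)` of `t + ‖z‖² / 2` exists and `-z₀` is a subgradient at it. -/
theorem exists_forall_sub_inner_le [CompleteSpace X] {E : Set (X × ℝ)} (hE : Convex ℝ E)
    (hcl : IsClosed E) (hne : E.Nonempty) {c : ℝ} (hc : ∀ q ∈ E, c ≤ q.2 + ‖q.1‖ ^ 2 / 2) :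
    ∃ q₀ ∈ E, ∀ q ∈ E, q₀.2 - inner ℝ q₀.1 (q.1 - q₀.1) ≤ q.2 := by
  set V : Set ℝ := (fun q : X × ℝ => q.2 + ‖q.1‖ ^ 2 / 2) '' E with hV
  have hVb : BddBelow V := ⟨c, by rintro _ ⟨q, hq, rfl⟩; exact hc q hq⟩
  have hm : ∀ q ∈ E, sInf V ≤ q.2 + ‖q.1‖ ^ 2 / 2 := fun q hq => csInf_le hVb ⟨q, hq, rfl⟩
  have hseq : ∀ n : ℕ, ∃ q ∈ E, q.2 + ‖q.1‖ ^ 2 / 2 ≤ sInf V + 1 / ((n : ℝ) + 1) := by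
    intro n
    obtain ⟨_, ⟨q, hq, rfl⟩, hlt⟩ := exists_lt_of_csInf_lt (hne.image _)
      (lt_add_of_pos_right (sInf V) (Nat.one_div_pos_of_nat (α := ℝ) (n := n)))
    exact ⟨q, hq, hlt.le⟩
  choose s hsE hs using hseq
  have hlim : Tendsto (fun n : ℕ => 1 / ((n : ℝ) + 1)) atTop (𝓝 0) :=
    tendsto_one_div_add_atTop_nhds_zero_nat
  have hcau : CauchySeq (fun n => (s n).1) := by
    refine cauchySeq_of_le_tendsto_0 (fun n : ℕ => √(8 * (1 / ((n : ℝ) + 1)))) ?_ ?_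
    · intro n k N hn hk
      rw [dist_eq_norm]
      refine Real.le_sqrt_of_sq_le ((norm_sub_sq_le_of_almost_min hE hm (hsE n) (hsE k)
        (hs n) (hs k)).trans ?_)
      have h1 := Nat.one_div_le_one_div (α := ℝ) hn
      have h2 := Nat.one_div_le_one_div (α := ℝ) hk
      linarith
    · simpa using (hlim.const_mul 8).sqrt
  obtain ⟨z, hz⟩ := cauchySeq_tendsto_of_complete hcau
  have hval : Tendsto (fun n => (s n).2 + ‖(s n).1‖ ^ 2 / 2) atTop (𝓝 (sInf V)) :=
    tendsto_of_tendsto_of_tendsto_of_le_of_le tendsto_const_nhds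
      (by simpa using hlim.const_add (sInf V)) (fun n => hm _ (hsE n)) hs
  have ht : Tendsto (fun n => (s n).2) atTop (𝓝 (sInf V - ‖z‖ ^ 2 / 2)) := by
    simpa using hval.sub ((hz.norm.pow 2).div_const 2)
  have hmem : (z, sInf V - ‖z‖ ^ 2 / 2) ∈ E :=
    hcl.mem_of_tendsto (hz.prodMk_nhds ht) (Eventually.of_forall hsE)
  refine ⟨_, hmem, fun q hq => ?_⟩
  -- Compare the minimizer with the points `(1 - r) q₀ + r q` and let `r` decrease to `0`.
  have hr : ∀ r : ℝ, 0 < r → r ≤ 1 →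
      sInf V - ‖z‖ ^ 2 / 2 - inner ℝ z (q.1 - z) ≤ q.2 + r * (‖q.1 - z‖ ^ 2 / 2) := by
    intro r hr0 hr1
    have h := hm _ (hE hmem hq (sub_nonneg.2 hr1) hr0.le (by ring))
    have e : (1 - r) • z + r • q.1 = z + r • (q.1 - z) := by module
    simp only [Prod.fst_add, Prod.smul_fst, Prod.snd_add, Prod.smul_snd, smul_eq_mul, e] at h
    rw [norm_add_sq_real, inner_smul_right, norm_smul, mul_pow, Real.norm_of_nonneg hr0.le] at h
    refine le_of_mul_le_mul_left ?_ hr0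
    nlinarith
  have hlim' : Tendsto (fun r : ℝ => q.2 + r * (‖q.1 - z‖ ^ 2 / 2)) (𝓝[>] 0) (𝓝 q.2) := by
    have : Tendsto (fun r : ℝ => q.2 + r * (‖q.1 - z‖ ^ 2 / 2)) (𝓝 0)
        (𝓝 (q.2 + 0 * (‖q.1 - z‖ ^ 2 / 2))) := Continuous.tendsto (by fun_prop) 0
    simpa using this.mono_left nhdsWithin_le_nhds
  refine ge_of_tendsto hlim' ?_
  filter_upwards [Ioc_mem_nhdsGT (zero_lt_one (α := ℝ))] with r h
  exact hr r h.1 h.2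

end Minimization

/-! ### Maximally monotone operators and Minty's theorem -/

section Minty

variable {H : Type*} [NormedAddCommGroup H] [InnerProductSpace ℝ H]

theorem IsMonotoneOp.inner_nonneg {A : H → Set H} (hA : IsMonotoneOp A) {x u a b : H}
    (hu : u ∈ A x) (hb : b ∈ A a) : 0 ≤ inner ℝ (x - a) (u - b) :=
  hA x u hu a b hb

/-- A point that is monotonically related to the whole graph of a maximally monotone operator
belongs to the graph. -/
theorem IsMaximallyMonotone.mem {A : H → Set H} (hA : IsMaximallyMonotone A) {x u : H}
    (h : ∀ a b, b ∈ A a → 0 ≤ inner ℝ (x - a) (u - b)) : u ∈ A x := by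
  by_contra hu
  refine hA.2 ⟨fun a => {b | b ∈ A a ∨ a = x ∧ b = u}, ?_, ?_, ?_⟩
  · rintro a b (hb | ⟨rfl, rfl⟩) a' b' (hb' | ⟨rfl, rfl⟩)
    · exact hA.1 a b hb a' b' hb'
    · have := h a b hb
      rwa [← neg_sub a, ← neg_sub b, inner_neg_neg] at this
    · exact h a' b' hb'
    · simp
  · exact fun p hp => Or.inl hp
  · exact fun hsub => hu (hsub (show (x, u) ∈ _ from Or.inr ⟨rfl, rfl⟩))

theorem IsMaximallyMonotone.exists_mem {A : H → Set H} (hA : IsMaximallyMonotone A) :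
    ∃ x u, u ∈ A x := by
  by_contra! h
  exact h 0 0 (hA.mem fun a b hb => absurd hb (h a b))

/-- The map `x + u ↦ u` is nonexpansive on the graph of a
monotone operator. -/
theorem IsMonotoneOp.norm_sub_le {A : H → Set H} (hA : IsMonotoneOp A) {x u a b : H}
    (hu : u ∈ A x) (hb : b ∈ A a) : ‖u - b‖ ≤ ‖(x + u) - (a + b)‖ := by
  have h := hA.inner_nonneg hu hb
  rw [show (x + u) - (a + b) = (x - a) + (u - b) by abel]
  refine (sq_le_sq₀ (norm_nonneg _) (norm_nonneg _)).1 ?_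
  rw [norm_add_sq_real]
  nlinarith [sq_nonneg ‖x - a‖]

/-- The epigraph, in `(H × H) × ℝ`, of the Fitzpatrick function
`(x, u) ↦ sup {⟪x, b⟫ + ⟪a, u⟫ - ⟪a, b⟫ | b ∈ A a}` of the operator `A`. The product `H × H` carries
its Hilbert norm. -/
def fitzpatrickEpi (A : H → Set H) : Set (WithLp 2 (H × H) × ℝ) :=
  {q | ∀ a b, b ∈ A a → inner ℝ q.1.fst b + inner ℝ a q.1.snd - inner ℝ a b ≤ q.2}

theorem convex_fitzpatrickEpi (A : H → Set H) : Convex ℝ (fitzpatrickEpi A) := by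
  intro q hq r hr s t hs ht hst a b hb
  have h1 := mul_le_mul_of_nonneg_left (hq a b hb) hs
  have h2 := mul_le_mul_of_nonneg_left (hr a b hb) ht
  simp only [Prod.fst_add, Prod.smul_fst, Prod.snd_add, Prod.smul_snd, smul_eq_mul,
    WithLp.add_fst, WithLp.smul_fst, WithLp.add_snd, WithLp.smul_snd, inner_add_left,
    inner_add_right, real_inner_smul_left, real_inner_smul_right]
  have h3 : inner ℝ a b = s * inner ℝ a b + t * inner ℝ a b := by rw [← add_mul, hst, one_mul]
  linarith

theorem isClosed_fitzpatrickEpi (A : H → Set H) : IsClosed (fitzpatrickEpi A) := by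
  have : fitzpatrickEpi A = ⋂ (a : H) (b : H) (_ : b ∈ A a),
      {q : WithLp 2 (H × H) × ℝ |
        inner ℝ q.1.fst b + inner ℝ a q.1.snd - inner ℝ a b ≤ q.2} := by
    ext q
    simp [fitzpatrickEpi]
  rw [this]
  have hf : Continuous fun q : WithLp 2 (H × H) × ℝ => q.1.fst :=
    (WithLp.prod_continuous_ofLp 2 H H).fst.comp continuous_fst
  have hg : Continuous fun q : WithLp 2 (H × H) × ℝ => q.1.snd :=
    (WithLp.prod_continuous_ofLp 2 H H).snd.comp continuous_fst
  refine isClosed_iInter fun a => isClosed_iInter fun b => isClosed_iInter fun _ =>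
    isClosed_le ?_ continuous_snd
  exact ((hf.inner continuous_const).add (continuous_const.inner hg)).sub continuous_const

theorem IsMonotoneOp.mem_fitzpatrickEpi {A : H → Set H} (hA : IsMonotoneOp A) {x u : H}
    (hu : u ∈ A x) : (WithLp.toLp 2 (x, u), inner ℝ x u) ∈ fitzpatrickEpi A := by
  intro a b hb
  have h := hA.inner_nonneg hu hb
  simp only [inner_sub_left, inner_sub_right] at h
  change inner ℝ x b + inner ℝ a u - inner ℝ a b ≤ inner ℝ x u
  linarith

/-- The Fitzpatrick function of a maximally monotone operator dominates the duality pairing. -/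
theorem IsMaximallyMonotone.inner_le_of_mem_fitzpatrickEpi {A : H → Set H}
    (hA : IsMaximallyMonotone A) {q : WithLp 2 (H × H) × ℝ} (hq : q ∈ fitzpatrickEpi A) :
    inner ℝ q.1.fst q.1.snd ≤ q.2 := by
  by_contra! hlt
  have h : ∀ a b, b ∈ A a → 0 < inner ℝ (q.1.fst - a) (q.1.snd - b) := by
    intro a b hb
    have := hq a b hb
    simp only [inner_sub_left, inner_sub_right]
    linarith
  simpa using h _ _ (hA.mem fun a b hb => (h a b hb).le)

variable [CompleteSpace H]

/-- Minty's theorem at the origin. -/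
theorem IsMaximallyMonotone.exists_neg_mem {A : H → Set H} (hA : IsMaximallyMonotone A) :
    ∃ x, -x ∈ A x := by
  obtain ⟨a₁, b₁, hb₁⟩ := hA.exists_mem
  obtain ⟨⟨z, t⟩, hq, hmin⟩ := exists_forall_sub_inner_le (c := 0) (convex_fitzpatrickEpi A)
    (isClosed_fitzpatrickEpi A) ⟨_, hA.1.mem_fitzpatrickEpi hb₁⟩ (by
      intro q hq
      have h1 := hA.inner_le_of_mem_fitzpatrickEpi hq
      have h2 := norm_add_sq_real q.1.fst q.1.snd
      rw [WithLp.prod_norm_sq_eq_of_L2]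
      nlinarith [sq_nonneg ‖q.1.fst + q.1.snd‖])
  have ht : inner ℝ z.fst z.snd ≤ t := hA.inner_le_of_mem_fitzpatrickEpi hq
  -- The subgradient inequality at the points of the graph says that the point
  -- `(-z.snd, -z.fst)` is monotonically related to the graph, with a margin.
  have key : ∀ a b, b ∈ A a →
      ‖z.fst + z.snd‖ ^ 2 ≤ inner ℝ (-z.snd - a) (-z.fst - b) := by
    intro a b hb
    have h := hmin _ (hA.1.mem_fitzpatrickEpi hb)
    rw [inner_sub_right, real_inner_self_eq_norm_sq, WithLp.prod_norm_sq_eq_of_L2] at h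
    change t - ((inner ℝ z.fst a + inner ℝ z.snd b) - (‖z.fst‖ ^ 2 + ‖z.snd‖ ^ 2)) ≤
      inner ℝ a b at h
    rw [norm_add_sq_real]
    simp only [inner_sub_left, inner_sub_right, inner_neg_left, inner_neg_right]
    rw [real_inner_comm z.fst z.snd, real_inner_comm z.fst a]
    linarith
  have hmem : -z.fst ∈ A (-z.snd) := hA.mem fun a b hb => (sq_nonneg _).trans (key a b hb)
  have h0 : z.fst + z.snd = 0 := by
    have := key _ _ hmem
    simpa using this
  rw [eq_neg_of_add_eq_zero_left h0] at hmem
  exact ⟨-z.snd, hmem⟩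

/-- Minty's theorem: if `A` is maximally monotone and `c > 0`, the operator `Id + c A` is onto. -/
theorem IsMaximallyMonotone.exists_mem_add_eq {A : H → Set H} (hA : IsMaximallyMonotone A)
    {c : ℝ} (hc : 0 < c) (w : H) : ∃ x u, u ∈ A x ∧ x + c • u = w := by
  -- Apply the case `w = 0`, `c = 1` to the operator `x ↦ c • A (x + w)`.
  have hmon : IsMonotoneOp fun x : H => {v | c⁻¹ • v ∈ A (x + w)} := by
    intro x u hu a b hb
    have h := hA.1.inner_nonneg hu hb
    rw [← smul_sub, add_sub_add_right_eq_sub, inner_smul_right] at h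
    exact nonneg_of_mul_nonneg_right h (inv_pos.2 hc)
  have hmax : IsMaximallyMonotone fun x : H => {v | c⁻¹ • v ∈ A (x + w)} := by
    refine ⟨hmon, ?_⟩
    rintro ⟨A', hA', hsub, hnot⟩
    refine hnot fun ⟨x, u⟩ hu => hA.mem fun a b hb => ?_
    have hb' : c • b ∈ A' (a - w) := hsub (show (a - w, c • b) ∈ gra _ by
      simpa [gra, smul_smul, inv_mul_cancel₀ hc.ne'] using hb)
    have h := hA'.inner_nonneg hu hb'
    have e : c⁻¹ • u - b = c⁻¹ • (u - c • b) := by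
      rw [smul_sub, smul_smul, inv_mul_cancel₀ hc.ne', one_smul]
    rw [e, inner_smul_right, show x + w - a = x - (a - w) by abel]
    exact mul_nonneg (inv_pos.2 hc).le h
  obtain ⟨x, hx⟩ := hmax.exists_neg_mem
  refine ⟨x + w, c⁻¹ • -x, hx, ?_⟩
  rw [smul_smul, mul_inv_cancel₀ hc.ne', one_smul]
  abel

/-- The solution `u` of `x + c u = w`, `u ∈ A x`, is a `c⁻¹`-Lipschitz function of `w`, so the
contraction principle allows a perturbation of `c Id` by a linear operator of norm less than `c`. -/
theorem IsMaximallyMonotone.exists_mem_add_smul_sub_eq {A : H → Set H}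
    (hA : IsMaximallyMonotone A) {c : ℝ} (hc : 0 < c) (Q : H →L[ℝ] H) (hQ : ‖Q‖ < c) (w : H) :
    ∃ x u, u ∈ A x ∧ x + c • u - Q u = w := by
  choose p y hy hpy using hA.exists_mem_add_eq hc
  have hlip : ∀ v v', ‖y v - y v'‖ ≤ ‖v - v'‖ / c := by
    intro v v'
    have h := hA.1.inner_nonneg (hy v) (hy v')
    have e : p v - p v' = (v - v') - c • (y v - y v') := by
      rw [eq_sub_of_add_eq (hpy v), eq_sub_of_add_eq (hpy v')]
      module
    rw [e, inner_sub_left, real_inner_smul_left, real_inner_self_eq_norm_sq] at h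
    have h' := real_inner_le_norm (v - v') (y v - y v')
    rw [le_div_iff₀ hc]
    rcases (norm_nonneg (y v - y v')).eq_or_lt with h0 | h0
    · rw [← h0, zero_mul]; exact norm_nonneg _
    · refine le_of_mul_le_mul_right ?_ h0
      nlinarith
  have hK : ContractingWith (‖Q‖₊ / c.toNNReal) fun u => y (w + Q u) := by
    refine ⟨?_, LipschitzWith.of_dist_le_mul fun u v => ?_⟩
    · rw [div_lt_one (by simpa using hc), ← NNReal.coe_lt_coe, coe_nnnorm,
        Real.coe_toNNReal _ hc.le]
      exact hQ
    · rw [dist_eq_norm, dist_eq_norm]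
      refine (hlip _ _).trans ?_
      rw [add_sub_add_left_eq_sub, ← map_sub, NNReal.coe_div, coe_nnnorm,
        Real.coe_toNNReal _ hc.le, div_mul_eq_mul_div]
      gcongr
      exact Q.le_opNorm _
  have hfix : y (w + Q (hK.fixedPoint _)) = hK.fixedPoint _ := hK.fixedPoint_isFixedPt
  set u := hK.fixedPoint _
  refine ⟨p (w + Q u), u, ?_, ?_⟩
  · have := hy (w + Q u)
    rwa [hfix] at this
  · have := hpy (w + Q u)
    rw [hfix] at this
    rw [this, add_sub_cancel_right]

end Minty

/-! ### The graph of the resolvent cocomposition -/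

section Cocomposition

variable {H G : Type*} [NormedAddCommGroup H] [InnerProductSpace ℝ H] [CompleteSpace H]
  [NormedAddCommGroup G] [InnerProductSpace ℝ G] [CompleteSpace G] {L : H →L[ℝ] G}
  {B : G → Set G} {γ : ℝ}

theorem mem_resolventCocomp {x u : H} :
    u ∈ resolventCocomp L γ B x ↔
      ∃ y, y ∈ B (L x - γ • (y - L (adjoint L y))) ∧ adjoint L y = u := by
  simp only [resolventCocomp, resolventComp, subId, parallelComp, inv, addId,
    ContinuousLinearMap.adjoint_adjoint, Set.mem_ofPred_eq, Set.mem_image, one_div, inv_inv]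
  constructor
  · rintro ⟨v, ⟨y, ⟨p, hp, hpv⟩, rfl⟩, rfl⟩
    refine ⟨y, ?_, rfl⟩
    convert hp using 2
    rw [map_sub, map_smul, ← hpv]
    module
  · rintro ⟨y, hy, rfl⟩
    refine ⟨x + γ • adjoint L y, ⟨y, ⟨_, hy, ?_⟩, rfl⟩, by abel⟩
    rw [map_add, map_smul]
    module

theorem norm_adjoint_apply_le (hL : ‖L‖ ≤ 1) (y : G) : ‖adjoint L y‖ ≤ ‖y‖ := by
  have h : ‖adjoint L‖ ≤ 1 := by rwa [LinearIsometryEquiv.norm_map]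
  exact ((adjoint L).le_of_opNorm_le h y).trans_eq (one_mul _)

theorem isMonotoneOp_resolventCocomp (hL : ‖L‖ ≤ 1) (hB : IsMonotoneOp B) (hγ : 0 ≤ γ) :
    IsMonotoneOp (resolventCocomp L γ B) := by
  intro x u hu a b hb
  obtain ⟨y, hy, rfl⟩ := mem_resolventCocomp.1 hu
  obtain ⟨v, hv, rfl⟩ := mem_resolventCocomp.1 hb
  have h := hB.inner_nonneg hy hv
  have e : L x - γ • (y - L (adjoint L y)) - (L a - γ • (v - L (adjoint L v))) =
      L (x - a) - γ • ((y - v) - L (adjoint L (y - v))) := by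
    simp only [map_sub]
    module
  rw [e, inner_sub_left, real_inner_smul_left, inner_sub_left, real_inner_self_eq_norm_sq,
    ← ContinuousLinearMap.adjoint_inner_right, ← ContinuousLinearMap.adjoint_inner_right,
    real_inner_self_eq_norm_sq] at h
  have h1 := pow_le_pow_left₀ (norm_nonneg _) (norm_adjoint_apply_le hL (y - v)) 2
  have h2 := mul_nonneg hγ (sub_nonneg.2 h1)
  rw [← map_sub]
  linarith

/-- The sum of the identity and the resolvent cocomposition is onto. -/
theorem exists_mem_resolventCocomp_add_eq (hL : ‖L‖ ≤ 1) (hB : IsMaximallyMonotone B)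
    (hγ : 0 < γ) (z : H) : ∃ x u, u ∈ resolventCocomp L γ B x ∧ x + u = z := by
  -- With `x = z - L* y`, the inclusion `y ∈ B p` has to hold at
  -- `p = L z - γ y - (1 - γ) L L* y`.
  suffices h : ∃ p y, y ∈ B p ∧ p + γ • y + (1 - γ) • L (adjoint L y) = L z by
    obtain ⟨p, y, hy, hp⟩ := h
    refine ⟨z - adjoint L y, adjoint L y, mem_resolventCocomp.2 ⟨y, ?_, rfl⟩, by abel⟩
    convert hy using 2
    rw [map_sub, ← hp]
    module
  have hLL : ∀ y, ‖L (adjoint L y)‖ ≤ ‖adjoint L y‖ := fun y =>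
    (L.le_of_opNorm_le hL _).trans_eq (one_mul _)
  rcases lt_or_ge γ 1 with h1 | h1
  · have hT : ‖ContinuousLinearMap.id ℝ G - L ∘L adjoint L‖ ≤ 1 := by
      refine ContinuousLinearMap.opNorm_le_bound _ zero_le_one fun y => ?_
      rw [one_mul]
      refine (sq_le_sq₀ (norm_nonneg _) (norm_nonneg _)).1 ?_
      change ‖y - L (adjoint L y)‖ ^ 2 ≤ _
      rw [norm_sub_sq_real, ← ContinuousLinearMap.adjoint_inner_left, real_inner_self_eq_norm_sq]
      nlinarith [pow_le_pow_left₀ (norm_nonneg _) (hLL y) 2, sq_nonneg ‖adjoint L y‖]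
    obtain ⟨p, y, hy, hp⟩ := hB.exists_mem_add_smul_sub_eq one_pos
      ((1 - γ) • (ContinuousLinearMap.id ℝ G - L ∘L adjoint L)) (by
        rw [norm_smul, Real.norm_of_nonneg (sub_nonneg.2 h1.le)]
        nlinarith) (L z)
    refine ⟨p, y, hy, ?_⟩
    rw [← hp]
    change _ = p + (1 : ℝ) • y - (1 - γ) • (y - L (adjoint L y))
    module
  · have hT : ‖L ∘L adjoint L‖ ≤ 1 := by
      refine ContinuousLinearMap.opNorm_le_bound _ zero_le_one fun y => ?_
      rw [one_mul]
      exact (hLL y).trans (norm_adjoint_apply_le hL y)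
    obtain ⟨p, y, hy, hp⟩ := hB.exists_mem_add_smul_sub_eq hγ ((γ - 1) • (L ∘L adjoint L)) (by
        rw [norm_smul, Real.norm_of_nonneg (sub_nonneg.2 h1)]
        nlinarith) (L z)
    refine ⟨p, y, hy, ?_⟩
    rw [← hp]
    change _ = p + γ • y - (γ - 1) • L (adjoint L y)
    module

/-- The resolvents of the resolvent cocomposition and of `L* ∘ B ∘ L` differ at a point by at most
`√γ / 2` times the norm of the element `y` of `B (L x)` given by the latter. -/
theorem norm_sub_sq_le (hL : ‖L‖ ≤ 1) (hB : IsMonotoneOp B) (hγ : 0 ≤ γ) {x x' : H} {y y' : G}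
    (hy : y ∈ B (L x)) (hy' : y' ∈ B (L x' - γ • (y' - L (adjoint L y'))))
    (hsum : x' + adjoint L y' = x + adjoint L y) : ‖x' - x‖ ^ 2 ≤ γ / 4 * ‖y‖ ^ 2 := by
  have h := hB.inner_nonneg hy' hy
  have e : L x' - γ • (y' - L (adjoint L y')) - L x =
      L (x' - x) - γ • (y' - L (adjoint L y')) := by
    rw [map_sub]
    abel
  have e' : adjoint L (y' - y) = -(x' - x) := by
    rw [map_sub, eq_sub_of_add_eq' hsum]
    abel
  rw [e, inner_sub_left, real_inner_smul_left, inner_sub_left,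
    ← ContinuousLinearMap.adjoint_inner_right, ← ContinuousLinearMap.adjoint_inner_right, e',
    inner_neg_right, real_inner_self_eq_norm_sq, ← e'] at h
  -- Positivity of `Id - L L*` at `y' - y / 2` replaces the Cauchy-Schwarz inequality.
  have h1 := pow_le_pow_left₀ (norm_nonneg _)
    (norm_adjoint_apply_le hL (y' - (1 / 2 : ℝ) • y)) 2
  rw [map_sub, map_smul, norm_sub_sq_real, norm_sub_sq_real, inner_smul_right, inner_smul_right,
    norm_smul, norm_smul] at h1
  norm_num [mul_pow] at h1
  simp only [map_sub, inner_sub_right, real_inner_self_eq_norm_sq] at h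
  have h2 := mul_nonneg hγ (sub_nonneg.2 h1)
  have h3 := mul_nonneg hγ (sq_nonneg ‖adjoint L y‖)
  linarith

theorem dist_le_sqrt_mul (hL : ‖L‖ ≤ 1) (hB : IsMonotoneOp B) (hγ : 0 ≤ γ) {x x' : H} {y y' : G}
    (hy : y ∈ B (L x)) (hy' : y' ∈ B (L x' - γ • (y' - L (adjoint L y'))))
    (hsum : x' + adjoint L y' = x + adjoint L y) {K : ℝ} (hK : ‖y‖ ≤ K) :
    dist (x', adjoint L y') (x, adjoint L y) ≤ √γ * K := by
  have h := norm_sub_sq_le hL hB hγ hy hy' hsum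
  have hx : ‖x' - x‖ ≤ √γ * K := by
    refine ((sq_le_sq₀ (b := √γ * ‖y‖) (norm_nonneg _) (by positivity)).1 ?_).trans
      (mul_le_mul_of_nonneg_left hK (Real.sqrt_nonneg γ))
    rw [mul_pow, Real.sq_sqrt hγ]
    nlinarith [mul_nonneg hγ (sq_nonneg ‖y‖)]
  rw [Prod.dist_eq, dist_eq_norm, dist_eq_norm, eq_sub_of_add_eq' hsum]
  refine max_le hx ?_
  rwa [show x + adjoint L y - x' - adjoint L y = -(x' - x) by abel, norm_neg]

/-! ### Graph-convergence -/

theorem graphConverges_resolventCocomp (hL : ‖L‖ ≤ 1) (hB : IsMaximallyMonotone B)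
    (hA : IsMaximallyMonotone (compositeOp L B)) {γ : ℕ → ℝ} (hγ : ∀ n, 0 < γ n)
    (hlim : Tendsto γ atTop (𝓝 0)) :
    GraphConverges (fun n => resolventCocomp L (γ n) B) (compositeOp L B) := by
  have hlow : gra (compositeOp L B) ⊆ lowerLimit fun n => gra (resolventCocomp L (γ n) B) := by
    rintro ⟨x, _⟩ ⟨y, hy, rfl⟩
    choose s v hv hs using fun n => exists_mem_resolventCocomp_add_eq hL hB (hγ n) (x + adjoint L y)
    refine ⟨fun n => (s n, v n), hv, ?_⟩
    rw [tendsto_iff_dist_tendsto_zero]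
    refine squeeze_zero (fun _ => dist_nonneg) (fun n => ?_) (g := fun n => √(γ n) * ‖y‖)
      (by simpa using hlim.sqrt.mul_const ‖y‖)
    obtain ⟨y', hy', e⟩ := mem_resolventCocomp.1 (hv n)
    have hsn := hs n
    rw [← e] at hsn ⊢
    exact dist_le_sqrt_mul hL hB.1 (hγ n).le hy hy' hsn le_rfl
  have hlu : lowerLimit (fun n => gra (resolventCocomp L (γ n) B)) ⊆
      upperLimit fun n => gra (resolventCocomp L (γ n) B) :=
    fun _ ⟨s, hs, hs'⟩ => ⟨s, id, strictMono_id, hs, hs'⟩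
  have hup : upperLimit (fun n => gra (resolventCocomp L (γ n) B)) ⊆ gra (compositeOp L B) := by
    rintro ⟨x, u⟩ ⟨s, k, hk, hs, hsx⟩
    refine hA.mem fun a b hb => ?_
    obtain ⟨r, hr, hra⟩ := hlow (show (a, b) ∈ gra (compositeOp L B) from hb)
    have h := hsx.sub (hra.comp hk.tendsto_atTop)
    refine ge_of_tendsto' (h.fst_nhds.inner h.snd_nhds) fun n => ?_
    exact (isMonotoneOp_resolventCocomp hL hB.1 (hγ (k n)).le).inner_nonneg (hs n) (hr (k n))
  exact ⟨(hlu.trans hup).antisymm hlow, hup.antisymm (hlow.trans hlu)⟩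

/-! ### Convergence in the `ρ`-Hausdorff distance -/

/-- Either of the two conditions bounds `y ∈ B (L x)` in terms of `L* y`. -/
theorem exists_norm_le_of_norm_adjoint_le
    (h : Bornology.IsBounded (ran fun x : H => B (L x)) ∨
      ∃ S : H →L[ℝ] G, IsUnit (S ∘L adjoint L : G →L[ℝ] G)) (R : ℝ) :
    ∃ K, ∀ x y, y ∈ B (L x) → ‖adjoint L y‖ ≤ R → ‖y‖ ≤ K := by
  rcases h with h | ⟨S, T, hT⟩
  · obtain ⟨K, hK⟩ := h.exists_norm_le
    exact ⟨K, fun x y hy _ => hK y ⟨x, hy⟩⟩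
  · refine ⟨‖(↑T⁻¹ : G →L[ℝ] G) ∘L S‖ * R, fun x y _ hR => ?_⟩
    have e : ((↑T⁻¹ : G →L[ℝ] G) ∘L S) (adjoint L y) = y := by
      have h1 : (↑T⁻¹ * ↑T : G →L[ℝ] G) y = y := by rw [T.inv_mul]; rfl
      rwa [hT] at h1
    calc ‖y‖ = ‖((↑T⁻¹ : G →L[ℝ] G) ∘L S) (adjoint L y)‖ := by rw [e]
      _ ≤ _ := (ContinuousLinearMap.le_opNorm _ _).trans
        (mul_le_mul_of_nonneg_left hR (norm_nonneg _))

/-- If every point of `C` in the ball of radius `ρ` is within `δ` of a point of `D` and vice versa,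
the `ρ`-Hausdorff distance of `C` and `D` is at most `δ`. -/
theorem hausSet_le {X : Type*} [NormedAddCommGroup X] {ρ δ : ℝ} {C D : Set X}
    (hCD : ∀ z ∈ C, ‖z‖ ≤ ρ → ∃ w ∈ D, dist z w ≤ δ)
    (hDC : ∀ z ∈ D, ‖z‖ ≤ ρ → ∃ w ∈ C, dist z w ≤ δ) : hausSet ρ C D ≤ ENNReal.ofReal δ := by
  have aux : ∀ C D : Set X, (∀ z ∈ C, ‖z‖ ≤ ρ → ∃ w ∈ D, dist z w ≤ δ) →
      excess (C ∩ Metric.closedBall 0 ρ) D ≤ ENNReal.ofReal δ := by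
    intro C D h
    refine iSup₂_le fun z hz => ?_
    obtain ⟨w, hw, hzw⟩ := h z hz.1 (mem_closedBall_zero_iff.1 hz.2)
    exact (Metric.infEDist_le_edist_of_mem hw).trans
      ((edist_dist z w).trans_le (ENNReal.ofReal_le_ofReal hzw))
  exact max_le (aux C D hCD) (aux D C hDC)

/-- If `y ∈ B (L x)` is bounded whenever `L* y` is, the `ρ`-Hausdorff distance between
the resolvent cocomposition and `L* ∘ B ∘ L` is of order `√γ`. -/
theorem exists_hausOp_resolventCocomp_le (hL : ‖L‖ ≤ 1) (hB : IsMaximallyMonotone B)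
    (hA : IsMaximallyMonotone (compositeOp L B))
    (hbd : ∀ R : ℝ, ∃ K, ∀ x y, y ∈ B (L x) → ‖adjoint L y‖ ≤ R → ‖y‖ ≤ K) (ρ : ℝ) :
    ∃ K, ∀ γ, 0 < γ →
      hausOp ρ (resolventCocomp L γ B) (compositeOp L B) ≤ ENNReal.ofReal (√γ * K) := by
  obtain ⟨x₀, u₀, hu₀, hsum₀⟩ := hA.exists_mem_add_eq one_pos 0
  rw [one_smul] at hsum₀
  obtain ⟨K₁, hK₁⟩ := hbd ρ
  -- The resolvent of `A` maps the ball of radius `2 ρ` into a ball, since it is nonexpansive.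
  obtain ⟨K₂, hK₂⟩ := hbd (ρ + ρ + ‖u₀‖)
  refine ⟨max K₁ K₂, fun γ hγ => hausSet_le ?_ ?_⟩
  · rintro ⟨x', u'⟩ hz hρ
    obtain ⟨y', hy', rfl⟩ := mem_resolventCocomp.1 hz
    obtain ⟨x, _, ⟨y, hy, rfl⟩, hsum⟩ := hA.exists_mem_add_eq one_pos (x' + adjoint L y')
    rw [one_smul] at hsum
    refine ⟨(x, adjoint L y), ⟨y, hy, rfl⟩,
      dist_le_sqrt_mul hL hB.1 hγ.le hy hy' hsum.symm ((hK₂ x y hy ?_).trans (le_max_right _ _))⟩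
    have h := hA.1.norm_sub_le (show adjoint L y ∈ compositeOp L B x from ⟨y, hy, rfl⟩) hu₀
    rw [hsum₀, sub_zero, hsum] at h
    have h1 := norm_add_le x' (adjoint L y')
    have h2 := (norm_fst_le _).trans hρ
    have h3 := (norm_snd_le _).trans hρ
    have h4 := norm_sub_norm_le (adjoint L y) u₀
    dsimp only at h2 h3
    linarith
  · rintro ⟨x, _⟩ ⟨y, hy, rfl⟩ hρ
    obtain ⟨x', u', hu', hsum⟩ := exists_mem_resolventCocomp_add_eq hL hB hγ (x + adjoint L y)
    obtain ⟨y', hy', rfl⟩ := mem_resolventCocomp.1 hu'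
    refine ⟨(x', adjoint L y'), hu', ?_⟩
    rw [dist_comm]
    exact dist_le_sqrt_mul hL hB.1 hγ.le hy hy' hsum
      ((hK₁ x y hy ((norm_snd_le _).trans hρ)).trans (le_max_left _ _))

end Cocomposition

end ResolventComp

theorem mainTheorem7 {H G : Type*}
    [NormedAddCommGroup H] [InnerProductSpace ℝ H] [CompleteSpace H]
    [NormedAddCommGroup G] [InnerProductSpace ℝ G] [CompleteSpace G]
    (L : H →L[ℝ] G) (hL : ‖L‖ ≤ 1)
    (B : G → Set G) (hB : ResolventComp.IsMaximallyMonotone B)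
    (hLBL : ResolventComp.IsMaximallyMonotone (ResolventComp.compositeOp L B)) :
    (∀ γ : ℕ → ℝ, (∀ n, 0 < γ n) → Tendsto γ atTop (𝓝 0) →
      ResolventComp.GraphConverges (fun n => ResolventComp.resolventCocomp L (γ n) B)
        (ResolventComp.compositeOp L B)) ∧
    ((Bornology.IsBounded (ResolventComp.ran (fun x : H => B (L x))) ∨
        ∃ S : H →L[ℝ] G, IsUnit (S ∘L ContinuousLinearMap.adjoint L : G →L[ℝ] G)) →
      ∀ ρ : ℝ, 0 < ρ →
        Tendsto (fun γ : ℝ => ResolventComp.hausOp ρ (ResolventComp.resolventCocomp L γ B)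
            (ResolventComp.compositeOp L B))
          (𝓝[>] 0) (𝓝 0)) := by
  refine ⟨fun γ hγ hlim => ResolventComp.graphConverges_resolventCocomp hL hB hLBL hγ hlim,
    fun h ρ _ => ?_⟩
  obtain ⟨K, hK⟩ := ResolventComp.exists_hausOp_resolventCocomp_le hL hB hLBL
    (ResolventComp.exists_norm_le_of_norm_adjoint_le h) ρ
  have hlim : Tendsto (fun γ : ℝ => ENNReal.ofReal (√γ * K)) (𝓝[>] 0) (𝓝 0) := by
    have h0 : Tendsto (fun γ : ℝ => ENNReal.ofReal (√γ * K)) (𝓝 0)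
        (𝓝 (ENNReal.ofReal (√0 * K))) :=
      (ENNReal.continuous_ofReal.comp (Real.continuous_sqrt.mul continuous_const)).tendsto 0
    simpa using h0.mono_left nhdsWithin_le_nhds
  refine tendsto_of_tendsto_of_tendsto_of_le_of_le' tendsto_const_nhds hlim
    (Eventually.of_forall fun _ => zero_le) ?_
  filter_upwards [self_mem_nhdsWithin] with γ hγ using hK γ hγ
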